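/- All topological spaces are assumed to be Tychonoff (completely regular Hausdorff). A topological space $X$ is called pseudocompact if every continuous function $X\to\mathbb R$ is bounded; weakly Lindelöf if every open cover $\mathcal U$ of $X$ contains a countable subfamily $\mathcal V\subset\mathcal U$ with $\bigcup\mathcal V$ dense in $X$; and openly factorizable if for every continuous map $f:X\to Y$ to a second countable space $Y$ there are a continuous open map $p:X\to Z$ onto a second countable space $Z$ and a continuous map $g:Z\to Y$ such that $f=g\circ p$. A topological semigroup (resp. semitopological semigroup) is a topological space with a jointly (resp. separately) continuous associative operation. For a topological semigroup $S$, let $\mathrm{WAP}(S)$ (resp. $\mathrm{AP}(S)$) be the compact Hausdorff semitopological (resp. topological) semigroup with a continuous homomorphism from $S$ through which every continuous homomorphism from $S$ to a compact Hausdorff semitopological (resp. topological) semigroup factors by a unique continuous homomorphism. The canonical map $\beta S\to\mathrm{WAP}(S)$ is the continuous extension to the Stone–Čech compactification $\beta S$ of the canonical homomorphism $S\to\mathrm{WAP}(S)$, and the canonical map $\mathrm{WAP}(S)\to\mathrm{AP}(S)$ is the unique continuous homomorphism compatible with the canonical homomorphisms from $S$. **Theorem.** Let $S$ be a pseudocompact,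 openly factorizable topological semigroup whose square $S\times S$ is weakly Lindelöf. Then the semigroup operation of $S$ extends to a jointly continuous semigroup operation on $\beta S$, so that $\beta S$ is a compact topological semigroup containing $S$ as a dense subsemigroup, and the canonical maps $\beta S\to\mathrm{WAP}(S)\to\mathrm{AP}(S)$ are homeomorphisms. -/

import Mathlib

open Topology Set

universe u v w

/-! ### Topological notions -/

/-- A space is pseudocompact if every continuous real-valued function on it is bounded. -/
def Pseudocompact (X : Type u) [TopologicalSpace X] : Prop :=
  ∀ f : X → ℝ, Continuous f → ∃ C : ℝ, ∀ x, |f x| ≤ C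

/-- A space is weakly Lindelöf if every open cover contains a countable subfamily with dense
union. -/
def WeaklyLindelof (X : Type u) [TopologicalSpace X] : Prop :=
  ∀ U : Set (Set X), (∀ A ∈ U, IsOpen A) → ⋃₀ U = univ →
    ∃ V ⊆ U, V.Countable ∧ Dense (⋃₀ V)

/-- A space `X` is openly factorizable if every continuous map from `X` to a second countable
(Tychonoff) space is the composition of a continuous open map of `X` onto a second countable
(Tychonoff) space and a continuous map. -/
def OpenlyFactorizable (X : Type u) [TopologicalSpace X] : Prop :=
  ∀ (Y : Type u) [TopologicalSpace Y] [T35Space Y] [SecondCountableTopology Y]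
    (f : X → Y), Continuous f →
    ∃ (Z : Type u) (_ : TopologicalSpace Z) (_ : T35Space Z) (_ : SecondCountableTopology Z)
      (p : X → Z) (g : Z → Y),
      Continuous p ∧ IsOpenMap p ∧ Function.Surjective p ∧ Continuous g ∧ f = g ∘ p

/-! ### Semigroup compactifications -/

/-- The two classes of compact Hausdorff semitopological semigroups under consideration. -/
inductive CompactSemigroupClass
  | WAP
  | AP

/-- Membership in a class: `WAP` consists of all compact Hausdorff semitopological semigroups
(the multiplication is separately continuous), and `AP` of all compact Hausdorff topological
semigroups (the multiplication is jointly continuous). -/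
def CompactSemigroupClass.Mem (c : CompactSemigroupClass) (K : Type v) [Semigroup K]
    [TopologicalSpace K] : Prop :=
  CompactSpace K ∧ T2Space K ∧
    match c with
    | .WAP => SeparatelyContinuousMul K
    | .AP => ContinuousMul K

/-- `(C, η)` is a `c`-compactification of `S`: `C` is in the class `c`, `η` is a continuous
homomorphism, and every continuous homomorphism from `S` to a semigroup `K` in the class `c`
factors through `η` by a unique continuous homomorphism. -/
structure IsSemigroupCompactification (c : CompactSemigroupClass) (S : Type u) [Semigroup S]
    [TopologicalSpace S] (C : Type v) [Semigroup C] [TopologicalSpace C] (η : S →ₙ* C) :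
    Prop where
  mem : c.Mem C
  continuous : Continuous η
  existsUnique_lift : ∀ (K : Type w) [Semigroup K] [TopologicalSpace K], c.Mem K →
    ∀ h : S →ₙ* K, Continuous h →
      ∃! g : C →ₙ* K, Continuous g ∧ ∀ s, g (η s) = h s

section Construction

variable (c : CompactSemigroupClass) (S : Type u) [Semigroup S] [TopologicalSpace S]

/-- A continuous homomorphism from `S` to a semigroup of the class `c` whose elements are
families of subsets of `S`. Up to isomorphism, every continuous homomorphism with dense image
from `S` to a semigroup of the class `c` is of this form. -/
structure SmallHom where
  carrier : Set (Set (Set S))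
  [semigroup : Semigroup carrier]
  [topology : TopologicalSpace carrier]
  mem : c.Mem carrier
  hom : S →ₙ* carrier
  continuous_hom : Continuous hom

attribute [instance] SmallHom.semigroup SmallHom.topology

instance (i : SmallHom c S) : CompactSpace i.carrier := i.mem.1

instance (i : SmallHom c S) : T2Space i.carrier := i.mem.2.1

theorem CompactSemigroupClass.Mem.separatelyContinuousMul {c : CompactSemigroupClass}
    {K : Type v} [Semigroup K] [TopologicalSpace K] (h : c.Mem K) :
    SeparatelyContinuousMul K := by
  cases c with
  | WAP => exact h.2.2
  | AP =>
    have : ContinuousMul K := h.2.2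
    infer_instance

instance (i : SmallHom c S) : SeparatelyContinuousMul i.carrier :=
  i.mem.separatelyContinuousMul

/-- The diagonal homomorphism of all the `SmallHom`s. -/
def diagonalHom : S →ₙ* ((i : SmallHom c S) → i.carrier) where
  toFun s i := i.hom s
  map_mul' s t := funext fun i => map_mul i.hom s t

/-- The closure of the image of `S` under the diagonal homomorphism, a closed subsemigroup of the
product. -/
def compactificationSubsemigroup : Subsemigroup ((i : SmallHom c S) → i.carrier) :=
  (diagonalHom c S).srange.topologicalClosure

/-- The `c`-compactification of `S`. -/
abbrev SemigroupCompactification : Type u := compactificationSubsemigroup c S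

instance : CompactSpace (SemigroupCompactification c S) :=
  isCompact_iff_compactSpace.mp
    (isClosed_closure (s := ((diagonalHom c S).srange : Set ((i : SmallHom c S) → i.carrier)))
      |>.isCompact)

theorem SemigroupCompactification.mem : c.Mem (SemigroupCompactification c S) := by
  refine ⟨inferInstance, inferInstance, ?_⟩
  cases c with
  | WAP => exact (compactificationSubsemigroup .WAP S).separatelyContinuousMul
  | AP =>
    have : ∀ i : SmallHom .AP S, ContinuousMul i.carrier := fun i => i.mem.2.2
    exact (compactificationSubsemigroup .AP S).continuousMul

/-- The canonical homomorphism from `S` to its `c`-compactification. -/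
def toCompactification : S →ₙ* SemigroupCompactification c S where
  toFun s := ⟨diagonalHom c S s, subset_closure ⟨s, rfl⟩⟩
  map_mul' s t := Subtype.ext (map_mul (diagonalHom c S) s t)

theorem continuous_toCompactification : Continuous (toCompactification c S) :=
  Continuous.subtype_mk (continuous_pi fun i => i.continuous_hom) _

theorem denseRange_toCompactification : DenseRange (toCompactification c S) := by
  have key : Subtype.val '' range (toCompactification c S) =
      ((diagonalHom c S).srange : Set ((i : SmallHom c S) → i.carrier)) := by
    ext y
    constructor
    · rintro ⟨_, ⟨s, rfl⟩, rfl⟩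
      exact ⟨s, rfl⟩
    · rintro ⟨s, rfl⟩
      exact ⟨_, ⟨s, rfl⟩, rfl⟩
  rintro ⟨x, hx⟩
  rw [closure_subtype, key]
  exact hx

/-- The `c`-compactification constructed above has the universal property that defines it. -/
theorem isSemigroupCompactification :
    IsSemigroupCompactification.{u, u, w} c S (SemigroupCompactification c S)
      (toCompactification c S) where
  mem := SemigroupCompactification.mem c S
  continuous := continuous_toCompactification c S
  existsUnique_lift K _ _ hK h hh := by
    have : T2Space K := hK.2.1
    have : CompactSpace K := hK.1
    have : SeparatelyContinuousMul K := hK.separatelyContinuousMul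
    -- the closure `L` of the image of `S`
    let L : Subsemigroup K := h.srange.topologicalClosure
    have hL : c.Mem L := by
      refine ⟨isCompact_iff_compactSpace.mp (isClosed_closure.isCompact), inferInstance, ?_⟩
      cases c with
      | WAP => exact L.separatelyContinuousMul
      | AP =>
        have : ContinuousMul K := hK.2.2
        exact L.continuousMul
    -- points of `L` are determined by the subsets of `S` to whose images they are adherent
    let e : L → Set (Set S) := fun z => {A | (z : K) ∈ closure (h '' A)}
    have he : Function.Injective e := by
      intro z w hzw
      by_contra hne
      obtain ⟨U, V, hU, hV, hzU, hwV, hUV⟩ := t2_separation (fun H => hne (Subtype.ext H))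
      have hz : h ⁻¹' U ∈ e z := by
        refine mem_closure_iff.2 fun O hO hzO => ?_
        obtain ⟨_, ⟨hy1, hy2⟩, ⟨s, rfl⟩⟩ :=
          mem_closure_iff.1 z.2 (O ∩ U) (hO.inter hU) ⟨hzO, hzU⟩
        exact ⟨h s, hy1, s, hy2, rfl⟩
      rw [hzw] at hz
      obtain ⟨_, hy, s, hs, rfl⟩ := mem_closure_iff.1 hz V hV hwV
      exact disjoint_left.1 hUV hs hy
    let E : L ≃ range e := Equiv.ofInjective e he
    let _ : Semigroup (range e) := E.symm.semigroup
    let _ : TopologicalSpace (range e) := TopologicalSpace.induced E.symm inferInstance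
    let H : range e ≃ₜ L := E.symm.toHomeomorphOfIsInducing ⟨rfl⟩
    let M : range e ≃* L := E.symm.mulEquiv
    have hMH : ∀ x, M x = H x := fun _ => rfl
    have hmem : c.Mem (range e) := by
      have := hL.1
      refine ⟨H.symm.compactSpace, H.symm.t2Space, ?_⟩
      cases c with
      | WAP =>
        have : SeparatelyContinuousMul L := hL.2.2
        exact IsInducing.separatelyContinuousMul M H.isInducing
      | AP =>
        have : ContinuousMul L := hL.2.2
        exact IsInducing.continuousMul M H.isInducing
    let hL' : S →ₙ* L :=
      { toFun := fun s => ⟨h s, subset_closure ⟨s, rfl⟩⟩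
        map_mul' := fun s t => Subtype.ext (map_mul h s t) }
    have hL'c : Continuous hL' := Continuous.subtype_mk hh _
    let i : SmallHom c S :=
      { carrier := range e
        mem := hmem
        hom := (M.symm : L →ₙ* range e).comp hL'
        continuous_hom := H.symm.continuous.comp hL'c }
    let g : SemigroupCompactification c S →ₙ* K :=
      { toFun := fun x => (H (x.1 i) : K)
        map_mul' := fun x y => by
          change ((M (x.1 i * y.1 i) : L) : K) = _
          rw [map_mul]
          rfl }
    have hg : Continuous g := continuous_subtype_val.comp
      (H.continuous.comp ((continuous_apply i).comp continuous_subtype_val))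
    have hgs : ∀ s, g (toCompactification c S s) = h s := fun s => by
      change ((H (H.symm (hL' s)) : L) : K) = h s
      rw [H.apply_symm_apply]
      rfl
    refine ⟨g, ⟨hg, hgs⟩, fun g' hg' => ?_⟩
    refine DFunLike.coe_injective ?_
    refine (denseRange_toCompactification c S).equalizer hg'.1 hg (funext fun s => ?_)
    exact (hg'.2 s).trans (hgs s).symm

end Construction

section CanonicalMaps

variable (S : Type u) [Semigroup S] [TopologicalSpace S]

/-- The weakly almost periodic compactification `WAP(S)`. -/
abbrev WAPCompactification : Type u := SemigroupCompactification .WAP S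

/-- The almost periodic compactification `AP(S)`. -/
abbrev APCompactification : Type u := SemigroupCompactification .AP S

/-- The canonical map `βS → WAP(S)`: the continuous extension to the Stone-Čech compactification
of the canonical homomorphism `S → WAP(S)`. -/
noncomputable def betaToWAP : StoneCech S → WAPCompactification S :=
  stoneCechExtend (continuous_toCompactification .WAP S)

theorem CompactSemigroupClass.Mem.wap {c : CompactSemigroupClass} {K : Type v} [Semigroup K]
    [TopologicalSpace K] (h : c.Mem K) : CompactSemigroupClass.WAP.Mem K :=
  ⟨h.1, h.2.1, h.separatelyContinuousMul⟩

theorem existsUnique_wapToAP :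
    ∃! g : WAPCompactification S →ₙ* APCompactification S, Continuous g ∧
      ∀ s, g (toCompactification .WAP S s) = toCompactification .AP S s :=
  (isSemigroupCompactification .WAP S).existsUnique_lift _
    (SemigroupCompactification.mem .AP S).wap _ (continuous_toCompactification .AP S)

/-- The canonical map `WAP(S) → AP(S)`: the unique continuous homomorphism compatible with the
canonical homomorphisms from `S`. -/
noncomputable def wapToAP : WAPCompactification S →ₙ* APCompactification S :=
  (existsUnique_wapToAP S).choose

theorem continuous_wapToAP : Continuous (wapToAP S) :=
  (existsUnique_wapToAP S).choose_spec.1.1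

theorem wapToAP_toCompactification (s : S) :
    wapToAP S (toCompactification .WAP S s) = toCompactification .AP S s :=
  (existsUnique_wapToAP S).choose_spec.1.2 s

end CanonicalMaps

/-! The key is that every continuous real function `F` on `S × S` extends to `βS × βS`. Weak
Lindelöfness yields, for each n, countably many boxes of small oscillation with dense union. Their
sides are cozero sets, so countably many real functions on `S` encode all of them, and open
factorizability gives an open map `p` onto a second countable `Z` whose fibres those functions
cannot split. Density and openness force `F` to be constant on fibres of `p × p`, so `F` descends to
`Z × Z` (`OpenlyFactorizable.exists_factorization_prod`). Pseudocompactness makes `Z` compact, so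
`p` extends to `βS`, and `F` with it.

Applied to real functions of the product `st`, this extends the operation to `βS`
(`IsDenseInducing.exists_continuous_extension`), and associativity passes over by density. Then `βS`
itself belongs to both classes, and the universal properties supply the inverse maps. -/

/-- A pseudocompact second countable Tychonoff space is compact. -/
theorem Pseudocompact.compactSpace {Z : Type u} [TopologicalSpace Z] [T35Space Z]
    [SecondCountableTopology Z] (hZ : Pseudocompact Z) : CompactSpace Z := by
  let _ := TopologicalSpace.metrizableSpaceMetric Z
  obtain ⟨e, he⟩ := Metric.PiNatEmbed.exists_embedding_to_hilbert_cube (X := Z)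
  let _ := TopologicalSpace.metrizableSpaceMetric (ℕ → unitInterval)
  have hcl : IsClosed (range e) := by
    refine isClosed_of_closure_subset fun q hq => ?_
    by_contra hqe
    have hpos : ∀ z, 0 < dist (e z) q := fun z =>
      dist_pos.2 fun h => hqe ⟨z, h⟩
    -- A missing limit point `q` would make the inverse distance to `q` continuous and unbounded.
    obtain ⟨C, hC⟩ := hZ (fun z => (dist (e z) q)⁻¹)
      ((he.continuous.dist continuous_const).inv₀ fun z => (hpos z).ne')
    have hC' : 0 < max C 1 := lt_max_of_lt_right one_pos
    obtain ⟨_, ⟨z, rfl⟩, hz⟩ := Metric.mem_closure_iff.1 hq (max C 1)⁻¹ (inv_pos.2 hC')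
    rw [dist_comm] at hz
    have h1 := (le_abs_self _).trans ((hC z).trans (le_max_left C 1))
    have h2 := (lt_inv_comm₀ (hpos z) hC').1 hz
    exact absurd h1 h2.not_ge
  exact (Topology.IsClosedEmbedding.mk he hcl).compactSpace

theorem Pseudocompact.of_surjective {X : Type u} {Z : Type v} [TopologicalSpace X]
    [TopologicalSpace Z] (hX : Pseudocompact X) {p : X → Z} (hp : Continuous p)
    (hs : Function.Surjective p) : Pseudocompact Z := by
  intro f hf
  obtain ⟨C, hC⟩ := hX (f ∘ p) (hf.comp hp)
  exact ⟨C, fun z => by obtain ⟨x, rfl⟩ := hs z; exact hC x⟩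

/-! ### Continuous functions on the square -/

/-- In a Tychonoff space, every neighbourhood contains a cozero neighbourhood. -/
theorem exists_continuous_ne_zero_of_mem_nhds {X : Type u} [TopologicalSpace X] [T35Space X]
    {x : X} {U : Set X} (hU : U ∈ 𝓝 x) :
    ∃ u : X → ℝ, Continuous u ∧ u x ≠ 0 ∧ ∀ y, u y ≠ 0 → y ∈ U := by
  obtain ⟨O, hOU, hO, hxO⟩ := mem_nhds_iff.1 hU
  obtain ⟨f, hf, hfx, hfO⟩ := CompletelyRegularSpace.completely_regular x Oᶜ hO.isClosed_compl
    (fun h => h hxO)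
  refine ⟨fun y => 1 - f y, by fun_prop, by simp [hfx], fun y hy => hOU ?_⟩
  by_contra hyO
  exact hy (by simp [hfO hyO])

/-- The open boxes with cozero sides on which the oscillation of `F` is at most `ε`. -/
def cozeroBoxes {X : Type u} [TopologicalSpace X] (F : X × X → ℝ) (ε : ℝ) : Set (Set (X × X)) :=
  {A | (∃ u v : X → ℝ, Continuous u ∧ Continuous v ∧ A = {x | u x.1 ≠ 0 ∧ v x.2 ≠ 0}) ∧
    ∀ a ∈ A, ∀ b ∈ A, dist (F a) (F b) ≤ ε}

theorem isOpen_of_mem_cozeroBoxes {X : Type u} [TopologicalSpace X] {F : X × X → ℝ} {ε : ℝ}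
    {A : Set (X × X)} (hA : A ∈ cozeroBoxes F ε) : IsOpen A := by
  obtain ⟨⟨u, v, hu, hv, rfl⟩, -⟩ := hA
  exact (isOpen_ne_fun (hu.comp continuous_fst) continuous_const).inter
    (isOpen_ne_fun (hv.comp continuous_snd) continuous_const)

/-- Continuity keeps `F` within `ε / 2` of its value at the centre on some box, and complete
regularity shrinks the sides to cozero sets. -/
theorem sUnion_cozeroBoxes {X : Type u} [TopologicalSpace X] [T35Space X] {F : X × X → ℝ}
    (hF : Continuous F) {ε : ℝ} (hε : 0 < ε) : ⋃₀ cozeroBoxes F ε = univ := by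
  refine eq_univ_of_forall fun ⟨x, y⟩ => ?_
  have hmem : F ⁻¹' Metric.ball (F (x, y)) (ε / 2) ∈ 𝓝 (x, y) :=
    hF.continuousAt (Metric.ball_mem_nhds _ (half_pos hε))
  obtain ⟨U, hU, V, hV, hUV⟩ := mem_nhds_prod_iff.1 hmem
  obtain ⟨u, hu, hux, huU⟩ := exists_continuous_ne_zero_of_mem_nhds hU
  obtain ⟨v, hv, hvy, hvV⟩ := exists_continuous_ne_zero_of_mem_nhds hV
  have hball : ∀ a ∈ {x : X × X | u x.1 ≠ 0 ∧ v x.2 ≠ 0}, dist (F a) (F (x, y)) < ε / 2 :=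
    fun a ha => hUV ⟨huU _ ha.1, hvV _ ha.2⟩
  refine ⟨_, ⟨⟨u, v, hu, hv, rfl⟩, fun a ha b hb => ?_⟩, hux, hvy⟩
  linarith [dist_triangle_right (F a) (F b) (F (x, y)), hball a ha, hball b hb]

/-- A continuous function on the weakly Lindelöf square of an openly factorizable space factors
through the square of a continuous open map onto a second countable space. -/
theorem OpenlyFactorizable.exists_factorization_prod {X : Type u} [TopologicalSpace X]
    [T35Space X] (hof : OpenlyFactorizable X) (hwl : WeaklyLindelof (X × X)) {F : X × X → ℝ}
    (hF : Continuous F) :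
    ∃ (Z : Type u) (_ : TopologicalSpace Z) (_ : T35Space Z) (_ : SecondCountableTopology Z)
      (p : X → Z) (G : Z × Z → ℝ), Continuous p ∧ Function.Surjective p ∧ Continuous G ∧
        ∀ x, F x = G (Prod.map p p x) := by
  have hε : ∀ n : ℕ, (0 : ℝ) < 1 / (n + 1) := fun n => Nat.one_div_pos_of_nat
  choose V hVU hVc hVd using fun n : ℕ => hwl (cozeroBoxes F (1 / (n + 1)))
    (fun A => isOpen_of_mem_cozeroBoxes) (sUnion_cozeroBoxes hF (hε n))
  choose u v hu hv hA using fun i : Σ n, V n => (hVU i.1 i.2.2).1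
  have : ∀ n, Countable (V n) := fun n => (hVc n).to_subtype
  -- The index type is countable, so the target is second countable.
  obtain ⟨Z, _, _, _, p, g, hp, hpo, hps, -, hfg⟩ := hof ((Σ n, V n) → ℝ × ℝ)
    (fun x i => (u i x, v i x)) (by fun_prop)
  have hsat : ∀ x y, p x = p y → ∀ i, u i x = u i y ∧ v i x = v i y := by
    intro x y hxy i
    have h := (congrFun hfg x).trans ((congrArg g hxy).trans (congrFun hfg y).symm)
    exact Prod.ext_iff.1 (congrFun h i)
  -- Openness of `p` is essential: a product of mere quotient maps need not be a quotient map.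
  have hP : IsOpenQuotientMap (Prod.map p p) :=
    ⟨hps.prodMap hps, hp.prodMap hp, hpo.prodMap hpo⟩
  have hconst : ∀ x y, Prod.map p p x = Prod.map p p y → F x = F y := by
    intro x y hxy
    refine eq_of_forall_dist_le fun δ hδ => ?_
    obtain ⟨n, hn⟩ := exists_nat_one_div_lt (show 0 < δ / 3 by positivity)
    have hball : ∀ z, IsOpen (F ⁻¹' Metric.ball (F z) (δ / 3)) := fun z =>
      Metric.isOpen_ball.preimage hF
    have hself : ∀ z, z ∈ F ⁻¹' Metric.ball (F z) (δ / 3) := fun z =>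
      Metric.mem_ball_self (by positivity)
    -- Points near `x` in value whose fibre meets the corresponding neighbourhood of `y`. The dense
    -- union of boxes meets this open set in some `a`, with a companion `b` in the same fibre.
    have hO : IsOpen (F ⁻¹' Metric.ball (F x) (δ / 3) ∩
        Prod.map p p ⁻¹' (Prod.map p p '' (F ⁻¹' Metric.ball (F y) (δ / 3)))) :=
      (hball x).inter ((hP.isOpenMap _ (hball y)).preimage hP.continuous)
    obtain ⟨a, ⟨hax, b, hby, hba⟩, A, hAV, haA⟩ :=
      (hVd n).inter_open_nonempty _ hO ⟨x, hself x, y, hself y, hxy.symm⟩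
    have hAeq := hA ⟨n, A, hAV⟩
    -- The sides of `A` are unions of fibres of `p`, so `A` contains `b` along with `a`.
    have hbA : b ∈ A := by
      change A = _ at hAeq
      rw [hAeq] at haA ⊢
      obtain ⟨h1, h2⟩ := Prod.ext_iff.1 hba
      exact ⟨(hsat _ _ h1 _).1 ▸ haA.1, (hsat _ _ h2 _).2 ▸ haA.2⟩
    have hab := (hVU n hAV).2 a haA b hbA
    rw [mem_preimage, Metric.mem_ball] at hax hby
    linarith [dist_triangle4 (F x) (F a) (F b) (F y), dist_comm (F x) (F a)]
  have hlift : (F ∘ Function.surjInv hP.surjective) ∘ Prod.map p p = F :=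
    funext fun x => hconst _ _ (Function.surjInv_eq hP.surjective _)
  refine ⟨Z, _, ‹_›, ‹_›, p, F ∘ Function.surjInv hP.surjective, hp, hps, ?_,
    fun x => (congrFun hlift x).symm⟩
  rw [hP.isQuotientMap.continuous_iff, hlift]
  exact hF

/-- A continuous function on the weakly Lindelöf square of a pseudocompact openly factorizable
space extends to the square of the Stone-Čech compactification. -/
theorem OpenlyFactorizable.exists_extension_prod {X : Type u} [TopologicalSpace X]
    [T35Space X] (hpc : Pseudocompact X) (hof : OpenlyFactorizable X)
    (hwl : WeaklyLindelof (X × X)) {F : X × X → ℝ} (hF : Continuous F) :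
    ∃ G : StoneCech X × StoneCech X → ℝ, Continuous G ∧
      ∀ x, G (Prod.map stoneCechUnit stoneCechUnit x) = F x := by
  obtain ⟨Z, _, _, _, p, G, hp, hps, hG, hFG⟩ := hof.exists_factorization_prod hwl hF
  have : CompactSpace Z := (hpc.of_surjective hp hps).compactSpace
  refine ⟨G ∘ Prod.map (stoneCechExtend hp) (stoneCechExtend hp), hG.comp
    ((continuous_stoneCechExtend hp).prodMap (continuous_stoneCechExtend hp)), fun x => ?_⟩
  rw [hFG]
  simp [Prod.map]

/-! ### Extending the operation -/

/-- A continuous map to a compact Hausdorff space extends along a dense embedding as soon as all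
its compositions with continuous real-valued functions do. -/
theorem IsDenseInducing.exists_continuous_extension {X : Type u} {B : Type v} {K : Type w}
    [TopologicalSpace X] [TopologicalSpace B] [TopologicalSpace K] [CompactSpace K] [T2Space K]
    {i : X → B} (hi : IsDenseInducing i) {f : X → K} (hf : Continuous f)
    (h : ∀ φ : K → ℝ, Continuous φ → ∃ G : B → ℝ, Continuous G ∧ ∀ x, G (i x) = φ (f x)) :
    ∃ g : B → K, Continuous g ∧ ∀ x, g (i x) = f x := by
  refine ⟨hi.extend f, hi.continuous_extend fun b => ?_, hi.extend_eq hf⟩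
  have hne := hi.comap_nhds_neBot b
  obtain ⟨c, hc⟩ := exists_clusterPt_of_compactSpace (Filter.map f (Filter.comap i (𝓝 b)))
  -- Two distinct cluster points would be separated by some `φ`, yet `φ ∘ f` converges to the single
  -- value `G b`.
  refine ⟨c, le_nhds_of_unique_clusterPt fun d hd => ?_⟩
  by_contra hdc
  obtain ⟨φ, hφ, hne'⟩ := separatesPoints_continuous_of_t35Space hdc
  obtain ⟨G, hG, hGf⟩ := h φ hφ
  have hlim : Filter.Tendsto (φ ∘ f) (Filter.comap i (𝓝 b)) (𝓝 (G b)) := by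
    have : φ ∘ f = G ∘ i := funext fun x => (hGf x).symm
    rw [this]
    exact (hG.tendsto b).comp Filter.tendsto_comap
  have key : ∀ k, ClusterPt k (Filter.map f (Filter.comap i (𝓝 b))) → φ k = G b := fun k hk =>
    eq_of_nhds_neBot (Filter.NeBot.mono
      (show ClusterPt (φ k) _ from hk.map hφ.continuousAt Filter.tendsto_map)
      (inf_le_inf_left _ (by rwa [Filter.map_map])))
  exact hne' ((key d hd).trans (key c hc).symm)

/-- The operation of a pseudocompact openly factorizable topological semigroup with weakly
Lindelöf square extends to a continuous semigroup operation on the Stone-Čech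
compactification. -/
theorem exists_semigroup_stoneCech {S : Type u} [Semigroup S] [TopologicalSpace S] [T35Space S]
    [ContinuousMul S] (hpc : Pseudocompact S) (hof : OpenlyFactorizable S)
    (hwl : WeaklyLindelof (S × S)) :
    ∃ _ : Semigroup (StoneCech S), ContinuousMul (StoneCech S) ∧
      ∀ s t : S, (stoneCechUnit (s * t) : StoneCech S) = stoneCechUnit s * stoneCechUnit t := by
  have hd : IsDenseInducing (stoneCechUnit : S → StoneCech S) := isDenseInducing_stoneCechUnit
  obtain ⟨m, hm, hms⟩ := (hd.prodMap hd).exists_continuous_extension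
    (f := fun x : S × S => (stoneCechUnit (x.1 * x.2) : StoneCech S))
    (continuous_stoneCechUnit.comp continuous_mul) fun φ hφ =>
      hof.exists_extension_prod hpc hwl
        (hφ.comp (continuous_stoneCechUnit.comp continuous_mul))
  have hms' : ∀ s t : S, m (stoneCechUnit s, stoneCechUnit t) = stoneCechUnit (s * t) :=
    fun s t => hms (s, t)
  have hassoc : ∀ a b c, m (m (a, b), c) = m (a, m (b, c)) :=
    hd.dense.induction_on₃ (isClosed_eq (by fun_prop) (by fun_prop)) fun s t r => by
      rw [hms', hms', hms', hms', mul_assoc]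
  let sg : Semigroup (StoneCech S) := { mul := fun a b => m (a, b), mul_assoc := hassoc }
  have hsg : ContinuousMul (StoneCech S) := ⟨hm⟩
  exact ⟨sg, hsg, fun s t => (hms' s t).symm⟩

/-! ### Comparison with the universal compactifications -/

/-- If the Stone-Čech compactification of `S` is a topological semigroup containing `S`, then it
is canonically isomorphic to both the `WAP` and the `AP` compactification. -/
theorem isHomeomorph_canonical_maps {S : Type u} [Semigroup S] [TopologicalSpace S]
    [Semigroup (StoneCech S)] [ContinuousMul (StoneCech S)]
    (hmul : ∀ s t : S,
      (stoneCechUnit (s * t) : StoneCech S) = stoneCechUnit s * stoneCechUnit t) :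
    IsHomeomorph (betaToWAP S) ∧ IsHomeomorph (wapToAP S) := by
  let ι : S →ₙ* StoneCech S := ⟨stoneCechUnit, hmul⟩
  have hmem : CompactSemigroupClass.AP.Mem (StoneCech S) :=
    ⟨inferInstance, inferInstance, inferInstanceAs (ContinuousMul (StoneCech S))⟩
  obtain ⟨g, ⟨hg, hgs⟩, -⟩ := (isSemigroupCompactification.{u, u} .WAP S).existsUnique_lift _
    hmem.wap ι continuous_stoneCechUnit
  obtain ⟨k, ⟨hk, hks⟩, -⟩ := (isSemigroupCompactification.{u, u} .AP S).existsUnique_lift _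
    hmem ι continuous_stoneCechUnit
  have hβ : Continuous (betaToWAP S) := continuous_stoneCechExtend _
  have hβs : ∀ s, betaToWAP S (stoneCechUnit s) = toCompactification .WAP S s :=
    stoneCechExtend_stoneCechUnit _
  have hw := continuous_wapToAP S
  have hws := wapToAP_toCompactification S
  have hgβ : ∀ x, g (betaToWAP S x) = x := congrFun <|
    denseRange_stoneCechUnit.equalizer (hg.comp hβ) continuous_id <| funext fun s => by
      simp only [Function.comp_apply, hβs, hgs]; rfl
  have hβg : ∀ x, betaToWAP S (g x) = x := congrFun <|
    (denseRange_toCompactification .WAP S).equalizer (hβ.comp hg) continuous_id <|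
      funext fun s => by
        simp only [Function.comp_apply, hgs]; exact hβs s
  -- The inverse of `wapToAP S` is `k` into `βS` followed by `betaToWAP S`.
  have hkw : ∀ x, betaToWAP S (k (wapToAP S x)) = x := congrFun <|
    (denseRange_toCompactification .WAP S).equalizer (hβ.comp (hk.comp hw)) continuous_id <|
      funext fun s => by
        simp only [Function.comp_apply, hws, hks]; exact hβs s
  have hwk : ∀ x, wapToAP S (betaToWAP S (k x)) = x := congrFun <|
    (denseRange_toCompactification .AP S).equalizer (hw.comp (hβ.comp hk)) continuous_id <|
      funext fun s => by
        simp only [Function.comp_apply, hks]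
        exact (congrArg _ (hβs s)).trans (hws s)
  exact ⟨(Homeomorph.mk ⟨betaToWAP S, g, hgβ, hβg⟩ hβ hg).isHomeomorph,
    (Homeomorph.mk ⟨wapToAP S, fun x => betaToWAP S (k x), hkw, hwk⟩ hw
      (hβ.comp hk)).isHomeomorph⟩

theorem mainTheorem4 (S : Type u) [Semigroup S] [TopologicalSpace S] [T35Space S]
    [ContinuousMul S] (hpc : Pseudocompact S) (hof : OpenlyFactorizable S)
    (hwl : WeaklyLindelof (S × S)) :
    (∃ _ : Semigroup (StoneCech S), ContinuousMul (StoneCech S) ∧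
      (∀ s t : S, (stoneCechUnit (s * t) : StoneCech S) = stoneCechUnit s * stoneCechUnit t) ∧
      IsDenseEmbedding (stoneCechUnit : S → StoneCech S)) ∧
    IsHomeomorph (betaToWAP S) ∧ IsHomeomorph (wapToAP S) := by
  obtain ⟨hsg, hcont, hmul⟩ := exists_semigroup_stoneCech hpc hof hwl
  exact ⟨⟨hsg, hcont, hmul, isDenseEmbedding_stoneCechUnit⟩, isHomeomorph_canonical_maps hmul⟩
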